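/- Let $C^*(\mathbb F_2)$ be the full group C*-algebra of the free group on two generators, i.e. the universal (unital) C*-algebra generated by two unitaries $U,V$. Let $\sigma$ be the order-two automorphism of $C^*(\mathbb F_2)$ with $\sigma(U)=V$ and $\sigma(V)=U$, and let $C^*(\mathbb F_2)_1=\{a\in C^*(\mathbb F_2):\sigma(a)=a\}$ be its fixed-point C*-algebra. Let $W$ be the canonical self-adjoint unitary of the crossed product $C^*(\mathbb F_2)\rtimes_\sigma\mathbb Z_2$, so that $W^2=1$ and $WaW=\sigma(a)$ for all $a\in C^*(\mathbb F_2)$ (in particular $WUW=V$), and let $\mathcal J$ be the closed two-sided ideal of $C^*(\mathbb F_2)\rtimes_\sigma\mathbb Z_2$ generated by the projection $p=\tfrac12(1+W)$. Then: 1. $C^*(\mathbb F_2)_1$ is strongly Morita equivalent to $\mathcal J$, i.e. there is a $C^*(\mathbb F_2)_1$-$\mathcal J$ imprimitivity bimodule. 2. There is a unique unital *-morphism $\varphi:C^*(\mathbb F_2)\rtimes_\sigma\mathbb Z_2\to C(\mathbb T)$ with $\varphi(W)=-1$ and $\varphi(U)(z)=\varphi(V)(z)=z$ for all $z\in\mathbb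 T$; it is surjective, and $\mathcal J=\ker\varphi$. -/

import Mathlib

noncomputable section

namespace SymmetricWords

universe u

/-! ### The `*`-algebra structure of a complex group algebra -/

section GroupAlgebra

variable {G : Type u} [Group G]

/-- The involution `(∑ c_g g)* = ∑ conj(c_g) g⁻¹` of the complex group algebra. -/
instance instStarGroupAlgebra : Star (MonoidAlgebra ℂ G) where
  star f := f.coeff.sum fun g c => MonoidAlgebra.single g⁻¹ (star c)

theorem star_single (g : G) (c : ℂ) :
    star (MonoidAlgebra.single g c) = MonoidAlgebra.single g⁻¹ (star c) := by
  change (MonoidAlgebra.single g c).coeff.sum _ = _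
  rw [MonoidAlgebra.coeff_single, Finsupp.sum_single_index (by simp)]

theorem star_add_groupAlgebra (x y : MonoidAlgebra ℂ G) : star (x + y) = star x + star y := by
  change (x + y).coeff.sum _ = x.coeff.sum _ + y.coeff.sum _
  rw [MonoidAlgebra.coeff_add, Finsupp.sum_add_index' (by simp) (by simp)]

theorem star_zero_groupAlgebra : star (0 : MonoidAlgebra ℂ G) = 0 := by
  change (0 : MonoidAlgebra ℂ G).coeff.sum _ = _
  simp

instance instStarRingGroupAlgebra : StarRing (MonoidAlgebra ℂ G) where
  star_involutive x := by
    induction x using MonoidAlgebra.induction_linear with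
    | zero => simp only [star_zero_groupAlgebra]
    | add x y hx hy => simp only [star_add_groupAlgebra, hx, hy]
    | single g c => simp only [star_single, star_star, inv_inv]
  star_add := star_add_groupAlgebra
  star_mul x y := by
    induction x using MonoidAlgebra.induction_linear with
    | zero => simp only [zero_mul, mul_zero, star_zero_groupAlgebra]
    | add x₁ x₂ h₁ h₂ => simp only [star_add_groupAlgebra, add_mul, mul_add, h₁, h₂]
    | single g c =>
      induction y using MonoidAlgebra.induction_linear with
      | zero => simp only [zero_mul, mul_zero, star_zero_groupAlgebra]
      | add y₁ y₂ h₁ h₂ => simp only [star_add_groupAlgebra, add_mul, mul_add, h₁, h₂]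
      | single h d =>
        simp only [star_single, MonoidAlgebra.single_mul_single, mul_inv_rev, star_mul]

instance instStarModuleGroupAlgebra : StarModule ℂ (MonoidAlgebra ℂ G) where
  star_smul z x := by
    induction x using MonoidAlgebra.induction_linear with
    | zero => simp only [smul_zero, star_zero_groupAlgebra]
    | add x y hx hy => simp only [smul_add, star_add_groupAlgebra, hx, hy]
    | single g c => simp only [star_single, MonoidAlgebra.smul_single, star_smul]

end GroupAlgebra

/-! ### Enveloping C⋆-algebras -/

section Envelope

/-- The norms of the images of `a` under all unital `*`-homomorphisms into C⋆-algebras. -/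
def repNorms (𝒜 : Type u) [Ring 𝒜] [StarRing 𝒜] [Algebra ℂ 𝒜] (a : 𝒜) : Set ℝ :=
  {r | ∃ (B : Type u) (_ : CStarAlgebra B) (π : 𝒜 →⋆ₐ[ℂ] B), r = ‖π a‖}

/-- A complex `*`-algebra all of whose elements have uniformly bounded images under all
`*`-homomorphisms into C⋆-algebras: exactly the condition for the enveloping C⋆-algebra to
exist. -/
class HasBoundedReps (𝒜 : Type u) [Ring 𝒜] [StarRing 𝒜] [Algebra ℂ 𝒜] : Prop where
  bddAbove : ∀ a : 𝒜, BddAbove (repNorms 𝒜 a)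

variable (𝒜 : Type u) [Ring 𝒜] [StarRing 𝒜] [Algebra ℂ 𝒜]

/-- The `*`-algebra `𝒜`, to be equipped with its universal C⋆-seminorm. -/
def PreEnvelope : Type u := 𝒜

instance : Ring (PreEnvelope 𝒜) := inferInstanceAs (Ring 𝒜)
instance : StarRing (PreEnvelope 𝒜) := inferInstanceAs (StarRing 𝒜)
instance : Algebra ℂ (PreEnvelope 𝒜) := inferInstanceAs (Algebra ℂ 𝒜)
instance [StarModule ℂ 𝒜] : StarModule ℂ (PreEnvelope 𝒜) := inferInstanceAs (StarModule ℂ 𝒜)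

/-- The universal C⋆-seminorm `‖a‖ = sup ‖π a‖`, over all unital `*`-homomorphisms `π` of `𝒜`
into C⋆-algebras. -/
instance : Norm (PreEnvelope 𝒜) where
  norm a := sSup (repNorms 𝒜 a)

variable {𝒜}

theorem preEnvelope_norm_nonneg (a : PreEnvelope 𝒜) : 0 ≤ ‖a‖ := by
  apply Real.sSup_nonneg
  rintro r ⟨B, _, π, rfl⟩
  exact norm_nonneg _

theorem norm_le_of_forall {a : PreEnvelope 𝒜} {C : ℝ} (hC : 0 ≤ C)
    (h : ∀ (B : Type u) (_ : CStarAlgebra B) (π : 𝒜 →⋆ₐ[ℂ] B), ‖π a‖ ≤ C) : ‖a‖ ≤ C := by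
  refine Real.sSup_le ?_ hC
  rintro r ⟨B, _, π, rfl⟩
  exact h B _ π

variable [HasBoundedReps 𝒜]

theorem norm_rep_le (a : PreEnvelope 𝒜) {B : Type u} [CStarAlgebra B] (π : 𝒜 →⋆ₐ[ℂ] B) :
    ‖π a‖ ≤ ‖a‖ :=
  le_csSup (HasBoundedReps.bddAbove (𝒜 := 𝒜) a) ⟨B, _, π, rfl⟩

instance : SeminormedRing (PreEnvelope 𝒜) :=
  { (inferInstance : Ring (PreEnvelope 𝒜)), (inferInstance : Norm (PreEnvelope 𝒜)),
    SeminormedAddCommGroup.ofCore (𝕜 := ℂ) (E := PreEnvelope 𝒜)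
      { norm_nonneg := preEnvelope_norm_nonneg
        norm_smul := by
          have key : ∀ (c : ℂ) (x : PreEnvelope 𝒜), ‖c • x‖ ≤ ‖c‖ * ‖x‖ := by
            intro c x
            refine norm_le_of_forall (mul_nonneg (norm_nonneg _) (preEnvelope_norm_nonneg _)) ?_
            intro B _ π
            have h : π (c • x : 𝒜) = c • π x := map_smul π c (x : 𝒜)
            change ‖π (c • x : 𝒜)‖ ≤ _
            rw [h, norm_smul]
            exact mul_le_mul_of_nonneg_left (norm_rep_le x π) (norm_nonneg _)
          intro c x
          refine le_antisymm (key c x) ?_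
          rcases eq_or_ne c 0 with rfl | hc
          · simpa using preEnvelope_norm_nonneg _
          · have h := key c⁻¹ (c • x)
            rw [inv_smul_smul₀ hc, norm_inv] at h
            rwa [inv_mul_eq_div, le_div_iff₀ (norm_pos_iff.mpr hc), mul_comm] at h
        norm_triangle := by
          intro x y
          refine norm_le_of_forall (add_nonneg (preEnvelope_norm_nonneg _) (preEnvelope_norm_nonneg _)) ?_
          intro B _ π
          have h : π (x + y : 𝒜) = π x + π y := map_add π (x : 𝒜) (y : 𝒜)
          change ‖π (x + y : 𝒜)‖ ≤ _
          rw [h]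
          exact (norm_add_le _ _).trans (add_le_add (norm_rep_le x π) (norm_rep_le y π)) } with
    norm_mul_le := by
      intro x y
      refine norm_le_of_forall (mul_nonneg (preEnvelope_norm_nonneg _) (preEnvelope_norm_nonneg _)) ?_
      intro B _ π
      have h : π (x * y : 𝒜) = π x * π y := map_mul π (x : 𝒜) (y : 𝒜)
      change ‖π (x * y : 𝒜)‖ ≤ _
      rw [h]
      exact (norm_mul_le _ _).trans
        (mul_le_mul (norm_rep_le x π) (norm_rep_le y π) (norm_nonneg _) (preEnvelope_norm_nonneg _)) }

instance : NormedAlgebra ℂ (PreEnvelope 𝒜) where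
  norm_smul_le c x := by
    refine norm_le_of_forall (mul_nonneg (norm_nonneg _) (preEnvelope_norm_nonneg _)) ?_
    intro B _ π
    have h : π (c • x : 𝒜) = c • π x := map_smul π c (x : 𝒜)
    change ‖π (c • x : 𝒜)‖ ≤ _
    rw [h, norm_smul]
    exact mul_le_mul_of_nonneg_left (norm_rep_le x π) (norm_nonneg _)

theorem norm_mul_self_le_preEnvelope (x : PreEnvelope 𝒜) : ‖x‖ * ‖x‖ ≤ ‖star x * x‖ := by
  have h : ‖x‖ ≤ √‖star x * x‖ := by
    refine norm_le_of_forall (Real.sqrt_nonneg _) ?_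
    intro B _ π
    refine Real.le_sqrt_of_sq_le ?_
    have h1 : ∀ y : 𝒜, π (star y * y) = star (π y) * π y := fun y => by
      rw [map_mul, map_star]
    rw [sq, ← CStarRing.norm_star_mul_self]
    exact (congrArg norm (h1 x)).symm.le.trans (norm_rep_le (star x * x) π)
  calc ‖x‖ * ‖x‖ ≤ √‖star x * x‖ * √‖star x * x‖ :=
        mul_le_mul h h (norm_nonneg _) (Real.sqrt_nonneg _)
    _ = ‖star x * x‖ := Real.mul_self_sqrt (norm_nonneg _)

instance : NormedStarGroup (PreEnvelope 𝒜) where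
  norm_star_le x := by
    refine norm_le_of_forall (norm_nonneg _) ?_
    intro B _ π
    have h : π (star x : 𝒜) = star (π x) := map_star π (x : 𝒜)
    change ‖π (star x : 𝒜)‖ ≤ _
    rw [h, norm_star]
    exact norm_rep_le x π

variable (𝒜) in
/-- The enveloping C⋆-algebra of `𝒜`: the Hausdorff completion of `𝒜` in its universal
C⋆-seminorm. -/
def CStarEnvelope : Type u := UniformSpace.Completion (PreEnvelope 𝒜)

namespace CStarEnvelope

open UniformSpace

instance : NormedRing (CStarEnvelope 𝒜) :=
  inferInstanceAs (NormedRing (Completion (PreEnvelope 𝒜)))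

instance : CompleteSpace (CStarEnvelope 𝒜) :=
  inferInstanceAs (CompleteSpace (Completion (PreEnvelope 𝒜)))

instance : NormedAlgebra ℂ (CStarEnvelope 𝒜) :=
  { (inferInstance : Algebra ℂ (Completion (PreEnvelope 𝒜))) with
    norm_smul_le := fun c x => norm_smul_le (β := Completion (PreEnvelope 𝒜)) c x }

/-- The canonical map of `𝒜` into its enveloping C⋆-algebra, as a bare function. -/
def of (a : 𝒜) : CStarEnvelope 𝒜 := ((show PreEnvelope 𝒜 from a : PreEnvelope 𝒜) :
  Completion (PreEnvelope 𝒜))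

theorem norm_of (a : 𝒜) : ‖of a‖ = ‖(show PreEnvelope 𝒜 from a)‖ := Completion.norm_coe _

theorem denseRange_of : DenseRange (of : 𝒜 → CStarEnvelope 𝒜) :=
  Completion.denseRange_coe (α := PreEnvelope 𝒜)

theorem induction {p : CStarEnvelope 𝒜 → Prop} (x : CStarEnvelope 𝒜)
    (hp : IsClosed {x | p x}) (h : ∀ a : 𝒜, p (of a)) : p x :=
  denseRange_of.induction_on x hp h

theorem of_add (a b : 𝒜) : of (a + b) = of a + of b :=
  Completion.coe_add (α := PreEnvelope 𝒜) a b

theorem of_mul (a b : 𝒜) : of (a * b) = of a * of b :=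
  Completion.coe_mul (α := PreEnvelope 𝒜) a b

theorem of_one : of (1 : 𝒜) = 1 := Completion.coe_one (α := PreEnvelope 𝒜)

theorem of_zero : of (0 : 𝒜) = 0 := Completion.coe_zero (α := PreEnvelope 𝒜)

theorem of_smul (c : ℂ) (a : 𝒜) : of (c • a) = c • of a :=
  Completion.coe_smul (X := PreEnvelope 𝒜) c a

theorem of_algebraMap (c : ℂ) :
    of (algebraMap ℂ 𝒜 c) = algebraMap ℂ (CStarEnvelope 𝒜) c := by
  rw [Algebra.algebraMap_eq_smul_one, Algebra.algebraMap_eq_smul_one, of_smul, of_one]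

/-- The involution of the completion, extending that of `𝒜` by continuity. -/
instance : Star (CStarEnvelope 𝒜) where
  star := Completion.map (star : PreEnvelope 𝒜 → PreEnvelope 𝒜)

theorem uniformContinuous_star_preEnvelope :
    UniformContinuous (star : PreEnvelope 𝒜 → PreEnvelope 𝒜) := by
  refine LipschitzWith.uniformContinuous (K := 1) (LipschitzWith.of_dist_le_mul ?_)
  intro x y
  rw [dist_eq_norm, dist_eq_norm, ← star_sub, norm_star, NNReal.coe_one, one_mul]

theorem star_of (a : 𝒜) : star (of a) = of (star a) :=
  Completion.map_coe uniformContinuous_star_preEnvelope _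

theorem continuous_star : Continuous (star : CStarEnvelope 𝒜 → CStarEnvelope 𝒜) :=
  Completion.continuous_map

instance : StarRing (CStarEnvelope 𝒜) where
  star_involutive x := by
    induction x using induction with
    | hp => exact isClosed_eq (continuous_star.comp continuous_star) continuous_id
    | h a => rw [star_of, star_of, star_star]
  star_add x y := by
    induction x using induction with
    | hp => exact isClosed_eq (continuous_star.comp (continuous_id.add continuous_const))
              (continuous_star.add continuous_const)
    | h a =>
      induction y using induction with
      | hp => exact isClosed_eq (continuous_star.comp (continuous_const.add continuous_id))
                (continuous_const.add continuous_star)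
      | h b => rw [← of_add, star_of, star_of, star_of, ← of_add, star_add]
  star_mul x y := by
    induction x using induction with
    | hp => exact isClosed_eq (continuous_star.comp (continuous_id.mul continuous_const))
              (continuous_const.mul continuous_star)
    | h a =>
      induction y using induction with
      | hp => exact isClosed_eq (continuous_star.comp (continuous_const.mul continuous_id))
                (continuous_star.mul continuous_const)
      | h b => rw [← of_mul, star_of, star_of, star_of, ← of_mul, star_mul]

instance : CStarRing (CStarEnvelope 𝒜) where
  norm_mul_self_le x := by
    induction x using induction with
    | hp => exact isClosed_le (continuous_norm.mul continuous_norm)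
              (continuous_norm.comp (continuous_star.mul continuous_id))
    | h a =>
      rw [star_of, ← of_mul, norm_of, norm_of]
      exact norm_mul_self_le_preEnvelope (𝒜 := 𝒜) a

section Lift

variable {B : Type u} [CStarAlgebra B]

/-- The extension of a `*`-homomorphism to the completion, as a bare function. -/
def liftFun (π : 𝒜 →⋆ₐ[ℂ] B) : CStarEnvelope 𝒜 → B :=
  Completion.extension (fun a : PreEnvelope 𝒜 => π a)

theorem continuous_liftFun (π : 𝒜 →⋆ₐ[ℂ] B) : Continuous (liftFun π) :=
  Completion.continuous_extension

theorem liftFun_of (π : 𝒜 →⋆ₐ[ℂ] B) (a : 𝒜) : liftFun π (of a) = π a := by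
  refine Completion.extension_coe (f := fun a : PreEnvelope 𝒜 => π a) ?_ _
  refine LipschitzWith.uniformContinuous (K := 1) (LipschitzWith.of_dist_le_mul ?_)
  intro x y
  rw [dist_eq_norm, dist_eq_norm, NNReal.coe_one, one_mul]
  have h : ∀ x y : 𝒜, π x - π y = π (x - y) := fun x y => (map_sub π x y).symm
  exact (congrArg norm (h x y)).le.trans (norm_rep_le (x - y) π)

end Lift

section StarModule

variable [StarModule ℂ 𝒜]

instance : StarModule ℂ (CStarEnvelope 𝒜) where
  star_smul c x := by
    induction x using induction with
    | hp => exact isClosed_eq (continuous_star.comp (continuous_const_smul c))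
              (continuous_star.const_smul (star c))
    | h a => rw [← of_smul, star_of, star_of, ← of_smul, star_smul]

instance : CStarAlgebra (CStarEnvelope 𝒜) where

/-- The canonical `*`-homomorphism of `𝒜` into its enveloping C⋆-algebra. -/
def ofHom : 𝒜 →⋆ₐ[ℂ] CStarEnvelope 𝒜 where
  toFun := of
  map_one' := of_one
  map_mul' := of_mul
  map_zero' := of_zero
  map_add' := of_add
  commutes' := of_algebraMap
  map_star' a := (star_of a).symm

variable {B : Type u} [CStarAlgebra B]

/-- The universal property: a unital `*`-homomorphism of `𝒜` into a C⋆-algebra extends to the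
enveloping C⋆-algebra. -/
def lift (π : 𝒜 →⋆ₐ[ℂ] B) : CStarEnvelope 𝒜 →⋆ₐ[ℂ] B where
  toFun := liftFun π
  map_one' := by rw [← of_one, liftFun_of, map_one]
  map_zero' := by rw [← of_zero, liftFun_of, map_zero]
  map_mul' x y := by
    have hc := continuous_liftFun π
    induction x using induction with
    | hp => exact isClosed_eq (hc.comp (continuous_id.mul continuous_const))
              (hc.mul continuous_const)
    | h a =>
      induction y using induction with
      | hp => exact isClosed_eq (hc.comp (continuous_const.mul continuous_id))
                (continuous_const.mul hc)
      | h b => rw [← of_mul, liftFun_of, liftFun_of, liftFun_of, map_mul]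
  map_add' x y := by
    have hc := continuous_liftFun π
    induction x using induction with
    | hp => exact isClosed_eq (hc.comp (continuous_id.add continuous_const))
              (hc.add continuous_const)
    | h a =>
      induction y using induction with
      | hp => exact isClosed_eq (hc.comp (continuous_const.add continuous_id))
                (continuous_const.add hc)
      | h b => rw [← of_add, liftFun_of, liftFun_of, liftFun_of, map_add]
  commutes' c := by rw [← of_algebraMap, liftFun_of, AlgHomClass.commutes]
  map_star' x := by
    have hc := continuous_liftFun π
    induction x using induction with
    | hp => exact isClosed_eq (hc.comp continuous_star) (hc.star)
    | h a => rw [star_of, liftFun_of, liftFun_of, map_star]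

theorem lift_ofHom (π : 𝒜 →⋆ₐ[ℂ] B) (a : 𝒜) : lift π (ofHom a) = π a := liftFun_of π a

theorem continuous_starHom {A B : Type u} [CStarAlgebra A] [CStarAlgebra B] (f : A →⋆ₐ[ℂ] B) :
    Continuous f := by
  refine AddMonoidHomClass.continuous_of_bound f 1 ?_
  intro x
  rw [one_mul]
  exact NonUnitalStarAlgHom.norm_apply_le f x

theorem hom_ext {f g : CStarEnvelope 𝒜 →⋆ₐ[ℂ] B} (h : ∀ a : 𝒜, f (ofHom a) = g (ofHom a)) :
    f = g := by
  ext x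
  induction x using induction with
  | hp => exact isClosed_eq (continuous_starHom f) (continuous_starHom g)
  | h a => exact h a

end StarModule

end CStarEnvelope

end Envelope

/-! ### Full group C⋆-algebras, `C*(𝔽₂)` and the flip -/

section GroupCStar

variable {G : Type u} [Group G]

instance : HasBoundedReps (MonoidAlgebra ℂ G) where
  bddAbove a := by
    induction a using MonoidAlgebra.induction_linear with
    | zero =>
      refine ⟨0, ?_⟩
      rintro r ⟨B, _, π, rfl⟩
      rw [map_zero, norm_zero]
    | add x y hx hy =>
      obtain ⟨C, hC⟩ := hx
      obtain ⟨D, hD⟩ := hy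
      refine ⟨C + D, ?_⟩
      rintro r ⟨B, _, π, rfl⟩
      rw [map_add]
      exact (norm_add_le _ _).trans (add_le_add (hC ⟨B, _, π, rfl⟩) (hD ⟨B, _, π, rfl⟩))
    | single g c =>
      refine ⟨‖c‖, ?_⟩
      rintro r ⟨B, _, π, rfl⟩
      have h1 : MonoidAlgebra.single g c = c • MonoidAlgebra.single g (1 : ℂ) := by
        rw [MonoidAlgebra.smul_single, smul_eq_mul, mul_one]
      have h2 : ‖π (MonoidAlgebra.single g (1 : ℂ))‖ ≤ 1 := by
        have h3 : star (MonoidAlgebra.single g (1 : ℂ)) * MonoidAlgebra.single g (1 : ℂ) = 1 := by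
          rw [star_single, MonoidAlgebra.single_mul_single, inv_mul_cancel, star_one, one_mul,
            MonoidAlgebra.one_def]
        have h4 : ‖π (MonoidAlgebra.single g (1 : ℂ))‖ * ‖π (MonoidAlgebra.single g (1 : ℂ))‖
            = ‖(1 : B)‖ := by
          rw [← CStarRing.norm_star_mul_self, ← map_star, ← map_mul, h3, map_one]
        have h5 : ‖(1 : B)‖ ≤ 1 := by
          rcases subsingleton_or_nontrivial B with hB | hB
          · rw [Subsingleton.elim (1 : B) 0, norm_zero]; exact zero_le_one
          · exact CStarRing.norm_one.le
        nlinarith [norm_nonneg (π (MonoidAlgebra.single g (1 : ℂ)))]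
      rw [h1, map_smul, norm_smul]
      exact mul_le_of_le_one_right (norm_nonneg _) h2

variable (G) in
/-- The full group C⋆-algebra `C*(G)` of a discrete group `G`: the enveloping C⋆-algebra of the
group algebra, i.e. the universal C⋆-algebra generated by a unitary representation of `G`. -/
abbrev GroupCStar : Type u := CStarEnvelope (MonoidAlgebra ℂ G)

/-- The canonical unitary of `C*(G)` attached to `g : G`. -/
def GroupCStar.of (g : G) : GroupCStar G := CStarEnvelope.ofHom (MonoidAlgebra.single g 1)

/-- The `*`-homomorphism of group algebras induced by a group homomorphism. -/
def groupAlgebraMap {H : Type u} [Group H] (f : G →* H) :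
    MonoidAlgebra ℂ G →⋆ₐ[ℂ] MonoidAlgebra ℂ H :=
  { MonoidAlgebra.mapDomainAlgHom ℂ ℂ f with
    map_star' := fun x => by
      change MonoidAlgebra.mapDomain f (star x) = star (MonoidAlgebra.mapDomain f x)
      induction x using MonoidAlgebra.induction_linear with
      | zero => simp only [star_zero, MonoidAlgebra.mapDomain_zero]
      | add x y hx hy => simp only [star_add, MonoidAlgebra.mapDomain_add, hx, hy]
      | single g c => simp only [star_single, MonoidAlgebra.mapDomain_single, map_inv] }

/-- The `*`-homomorphism `C*(G) → C*(H)` induced by a group homomorphism `G → H`. -/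
def GroupCStar.map {H : Type u} [Group H] (f : G →* H) : GroupCStar G →⋆ₐ[ℂ] GroupCStar H :=
  CStarEnvelope.lift (CStarEnvelope.ofHom.comp (groupAlgebraMap f))

end GroupCStar

/-- An automorphism `σ` of a C⋆-algebra with `σ ∘ σ = id`, i.e. an action of `ℤ/2`. -/
structure StarInvolution (A : Type u) [CStarAlgebra A] where
  /-- the automorphism -/
  aut : A ≃⋆ₐ[ℂ] A
  aut_aut : ∀ a, aut (aut a) = a

/-- `C*(𝔽₂)`, the universal C⋆-algebra generated by two unitaries. -/
abbrev CStarF2 : Type := GroupCStar (FreeGroup (Fin 2))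

namespace CStarF2

/-- The first universal unitary. -/
def U : CStarF2 := GroupCStar.of (FreeGroup.of 0)

/-- The second universal unitary. -/
def V : CStarF2 := GroupCStar.of (FreeGroup.of 1)

/-- The `*`-endomorphism of `C*(𝔽₂)` exchanging the two generators of `𝔽₂`. -/
def flipHom : CStarF2 →⋆ₐ[ℂ] CStarF2 := GroupCStar.map (FreeGroup.map (Equiv.swap (0 : Fin 2) 1))

theorem flipHom_of (g : FreeGroup (Fin 2)) :
    flipHom (GroupCStar.of g) = GroupCStar.of (FreeGroup.map (Equiv.swap (0 : Fin 2) 1) g) := by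
  rw [flipHom, GroupCStar.map, GroupCStar.of, CStarEnvelope.lift_ofHom]
  change CStarEnvelope.ofHom (MonoidAlgebra.mapDomain _ _) = _
  rw [MonoidAlgebra.mapDomain_single]
  rfl

theorem flipHom_U : flipHom U = V := by
  rw [U, flipHom_of, FreeGroup.map.of, Equiv.swap_apply_left, V]

theorem flipHom_V : flipHom V = U := by
  rw [V, flipHom_of, FreeGroup.map.of, Equiv.swap_apply_right, U]

theorem flipHom_flipHom (a : CStarF2) : flipHom (flipHom a) = a := by
  have h : flipHom.comp flipHom = StarAlgHom.id ℂ CStarF2 := by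
    refine CStarEnvelope.hom_ext fun x => ?_
    change flipHom (flipHom (CStarEnvelope.ofHom x)) = CStarEnvelope.ofHom x
    induction x using MonoidAlgebra.induction_linear with
    | zero => simp only [map_zero]
    | add x y hx hy => simp only [map_add, hx, hy]
    | single g c =>
      have h1 : MonoidAlgebra.single g c = c • MonoidAlgebra.single g (1 : ℂ) := by
        rw [MonoidAlgebra.smul_single, smul_eq_mul, mul_one]
      have h2 : flipHom (flipHom (GroupCStar.of g)) = GroupCStar.of g := by
        rw [flipHom_of, flipHom_of, FreeGroup.map.comp]
        have : (⇑(Equiv.swap (0 : Fin 2) 1) ∘ ⇑(Equiv.swap (0 : Fin 2) 1)) = id := by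
          funext i; simp
        rw [this, FreeGroup.map.id]
      rw [h1, map_smul, map_smul, map_smul]
      exact congrArg (c • ·) h2
  exact DFunLike.congr_fun h a

/-- The order-two automorphism `σ` of `C*(𝔽₂)` with `σ(U) = V` and `σ(V) = U`. -/
def σ : StarInvolution CStarF2 where
  aut := StarAlgEquiv.ofBijective flipHom
    (Function.Involutive.bijective flipHom_flipHom)
  aut_aut := flipHom_flipHom

end CStarF2

/-! ### Fixed-point algebras -/

/-- The fixed-point C⋆-algebra `A₁ = {a ∈ A : σ(a) = a}`. -/
def fixedPoints {A : Type u} [CStarAlgebra A] (σ : StarInvolution A) : StarSubalgebra ℂ A where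
  carrier := {a | σ.aut a = a}
  mul_mem' {a b} ha hb := by
    rw [Set.mem_ofPred_eq] at *; rw [map_mul, ha, hb]
  add_mem' {a b} ha hb := by
    rw [Set.mem_ofPred_eq] at *; rw [map_add, ha, hb]
  algebraMap_mem' c := by
    rw [Set.mem_ofPred_eq, AlgHomClass.commutes]
  star_mem' {a} ha := by
    change σ.aut (star a) = star a
    rw [map_star, show σ.aut a = a from ha]

instance isClosed_fixedPoints {A : Type u} [CStarAlgebra A] (σ : StarInvolution A) :
    IsClosed (fixedPoints σ : Set A) :=
  isClosed_eq (CStarEnvelope.continuous_starHom (σ.aut : A →⋆ₐ[ℂ] A)) continuous_id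

/-! ### The crossed product by `ℤ/2` -/

section CrossedProduct

variable {A : Type u} [CStarAlgebra A]

/-- The algebraic crossed product of `A` by `ℤ/2` acting through `σ`: formal sums `a + b W`, with
`W ^ 2 = 1`, `W* = W` and `W a W* = σ(a)`. -/
@[ext]
structure SkewAlgebra (σ : StarInvolution A) : Type u where
  /-- the coefficient of `1` -/
  coeffOne : A
  /-- the coefficient of `W` -/
  coeffW : A

namespace SkewAlgebra

variable {σ : StarInvolution A}

instance : Zero (SkewAlgebra σ) := ⟨⟨0, 0⟩⟩
instance : One (SkewAlgebra σ) := ⟨⟨1, 0⟩⟩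
instance : Add (SkewAlgebra σ) := ⟨fun x y => ⟨x.1 + y.1, x.2 + y.2⟩⟩
instance : Neg (SkewAlgebra σ) := ⟨fun x => ⟨-x.1, -x.2⟩⟩
instance : Mul (SkewAlgebra σ) :=
  ⟨fun x y => ⟨x.1 * y.1 + x.2 * σ.aut y.2, x.1 * y.2 + x.2 * σ.aut y.1⟩⟩
instance : Star (SkewAlgebra σ) := ⟨fun x => ⟨star x.1, σ.aut (star x.2)⟩⟩
instance : SMul ℂ (SkewAlgebra σ) := ⟨fun c x => ⟨c • x.1, c • x.2⟩⟩

@[simp] theorem zero_fst : (0 : SkewAlgebra σ).coeffOne = 0 := rfl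
@[simp] theorem zero_snd : (0 : SkewAlgebra σ).coeffW = 0 := rfl
@[simp] theorem one_fst : (1 : SkewAlgebra σ).coeffOne = 1 := rfl
@[simp] theorem one_snd : (1 : SkewAlgebra σ).coeffW = 0 := rfl
@[simp] theorem add_fst (x y : SkewAlgebra σ) : (x + y).coeffOne = x.coeffOne + y.coeffOne := rfl
@[simp] theorem add_snd (x y : SkewAlgebra σ) : (x + y).coeffW = x.coeffW + y.coeffW := rfl
@[simp] theorem neg_fst (x : SkewAlgebra σ) : (-x).coeffOne = -x.coeffOne := rfl
@[simp] theorem neg_snd (x : SkewAlgebra σ) : (-x).coeffW = -x.coeffW := rfl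
@[simp] theorem mul_fst (x y : SkewAlgebra σ) :
    (x * y).coeffOne = x.coeffOne * y.coeffOne + x.coeffW * σ.aut y.coeffW := rfl
@[simp] theorem mul_snd (x y : SkewAlgebra σ) :
    (x * y).coeffW = x.coeffOne * y.coeffW + x.coeffW * σ.aut y.coeffOne := rfl
@[simp] theorem star_fst (x : SkewAlgebra σ) : (star x).coeffOne = star x.coeffOne := rfl
@[simp] theorem star_snd (x : SkewAlgebra σ) : (star x).coeffW = σ.aut (star x.coeffW) := rfl
@[simp] theorem smul_fst (c : ℂ) (x : SkewAlgebra σ) : (c • x).coeffOne = c • x.coeffOne := rfl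
@[simp] theorem smul_snd (c : ℂ) (x : SkewAlgebra σ) : (c • x).coeffW = c • x.coeffW := rfl

instance : Ring (SkewAlgebra σ) where
  add_assoc x y z := by ext <;> simp [add_assoc]
  zero_add x := by ext <;> simp
  add_zero x := by ext <;> simp
  add_comm x y := by ext <;> simp [add_comm]
  neg_add_cancel x := by ext <;> simp
  nsmul := nsmulRec
  zsmul := zsmulRec
  mul_assoc x y z := by
    ext <;> simp only [mul_fst, mul_snd, map_add, map_mul, σ.aut_aut] <;> noncomm_ring
  one_mul x := by ext <;> simp
  mul_one x := by ext <;> simp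
  zero_mul x := by ext <;> simp
  mul_zero x := by ext <;> simp
  left_distrib x y z := by
    ext <;> simp only [mul_fst, mul_snd, add_fst, add_snd, map_add] <;> noncomm_ring
  right_distrib x y z := by
    ext <;> simp only [mul_fst, mul_snd, add_fst, add_snd] <;> noncomm_ring

instance : StarRing (SkewAlgebra σ) where
  star_involutive x := by
    ext
    · simp
    · simp only [star_snd, ← map_star, star_star, σ.aut_aut]
  star_add x y := by ext <;> simp
  star_mul x y := by
    ext
    · simp only [star_fst, mul_fst, star_snd, star_add, star_mul, map_star, σ.aut_aut]
    · simp only [star_fst, mul_snd, star_snd, star_add, star_mul, map_add, map_mul, map_star,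
        σ.aut_aut]
      rw [add_comm]

instance : Module ℂ (SkewAlgebra σ) where
  one_smul x := by ext <;> simp
  mul_smul c d x := by ext <;> simp [mul_smul]
  smul_zero c := by ext <;> simp
  smul_add c x y := by ext <;> simp
  add_smul c d x := by ext <;> simp [add_smul]
  zero_smul x := by ext <;> simp

instance : Algebra ℂ (SkewAlgebra σ) :=
  Algebra.ofModule
    (fun c x y => by ext <;> simp)
    (fun c x y => by ext <;> simp [map_smul])

instance : StarModule ℂ (SkewAlgebra σ) where
  star_smul c x := by ext <;> simp [map_smul]

/-- The inclusion `a ↦ a + 0 W`. -/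
def incl (σ : StarInvolution A) : A →⋆ₐ[ℂ] SkewAlgebra σ where
  toFun a := ⟨a, 0⟩
  map_one' := rfl
  map_zero' := rfl
  map_mul' a b := by ext <;> simp
  map_add' a b := by ext <;> simp
  commutes' c := by
    rw [Algebra.algebraMap_eq_smul_one, Algebra.algebraMap_eq_smul_one]
    ext <;> simp
  map_star' a := by ext <;> simp

/-- The element `W` implementing `σ`. -/
def W (σ : StarInvolution A) : SkewAlgebra σ := ⟨0, 1⟩

theorem star_W : star (W σ) = W σ := by ext <;> simp [W]

theorem W_mul_W : W σ * W σ = 1 := by ext <;> simp [W]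

theorem eq_incl_add (x : SkewAlgebra σ) : x = incl σ x.1 + incl σ x.2 * W σ := by
  ext <;> simp [W, incl]

instance : HasBoundedReps (SkewAlgebra σ) where
  bddAbove x := by
    refine ⟨‖x.1‖ + ‖x.2‖, ?_⟩
    rintro r ⟨B, _, π, rfl⟩
    have hW : ‖π (W σ)‖ ≤ 1 := by
      have h4 : ‖π (W σ)‖ * ‖π (W σ)‖ = ‖(1 : B)‖ := by
        rw [← CStarRing.norm_star_mul_self, ← map_star, ← map_mul, star_W, W_mul_W, map_one]
      have h5 : ‖(1 : B)‖ ≤ 1 := by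
        rcases subsingleton_or_nontrivial B with hB | hB
        · rw [Subsingleton.elim (1 : B) 0, norm_zero]; exact zero_le_one
        · exact CStarRing.norm_one.le
      nlinarith [norm_nonneg (π (W σ))]
    have hA : ∀ a : A, ‖π (incl σ a)‖ ≤ ‖a‖ :=
      fun a => NonUnitalStarAlgHom.norm_apply_le (π.comp (incl σ)) a
    have hx := congrArg π (eq_incl_add x)
    rw [map_add, map_mul] at hx
    rw [hx]
    refine (norm_add_le _ _).trans (add_le_add (hA _) ((norm_mul_le _ _).trans ?_))
    exact (mul_le_mul (hA _) hW (norm_nonneg _) (norm_nonneg _)).trans_eq (mul_one _)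

end SkewAlgebra

/-- The C⋆-crossed product `A ⋊_σ ℤ/2`: the enveloping C⋆-algebra of the algebraic crossed
product, i.e. the universal C⋆-algebra generated by a copy of `A` and a unitary `W` with
`W ^ 2 = 1` and `W a W* = σ(a)`. -/
abbrev CrossedProduct (σ : StarInvolution A) : Type u := CStarEnvelope (SkewAlgebra σ)

namespace CrossedProduct

/-- The canonical `*`-homomorphism `A → A ⋊_σ ℤ/2`. -/
def incl (σ : StarInvolution A) : A →⋆ₐ[ℂ] CrossedProduct σ :=
  CStarEnvelope.ofHom.comp (SkewAlgebra.incl σ)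

/-- The canonical unitary of `A ⋊_σ ℤ/2`. -/
def W (σ : StarInvolution A) : CrossedProduct σ := CStarEnvelope.ofHom (SkewAlgebra.W σ)

/-- The relation `W a W = σ(a)`. -/
theorem W_mul_incl_mul_W (σ : StarInvolution A) (a : A) :
    W σ * incl σ a * W σ = incl σ (σ.aut a) := by
  have h : SkewAlgebra.W σ * SkewAlgebra.incl σ a * SkewAlgebra.W σ
      = SkewAlgebra.incl σ (σ.aut a) := by
    ext <;> simp [SkewAlgebra.W, SkewAlgebra.incl]
  have h' := congrArg CStarEnvelope.ofHom h
  rwa [map_mul, map_mul] at h'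

/-- The projection `p = (1 + W) / 2`. -/
def p (σ : StarInvolution A) : CrossedProduct σ := (1 / 2 : ℂ) • (1 + W σ)

theorem isSelfAdjoint_p (σ : StarInvolution A) : IsSelfAdjoint (p σ) := by
  have h : star (W σ) = W σ := by
    rw [W, ← map_star, SkewAlgebra.star_W]
  rw [IsSelfAdjoint, p, star_smul, star_add, star_one, h]
  simp

end CrossedProduct

end CrossedProduct

/-! ### Closed ideals -/

section Ideal

variable {A : Type u} [CStarAlgebra A]

theorem star_mem_span {s : A} (hs : IsSelfAdjoint s) {x : A}
    (hx : x ∈ TwoSidedIdeal.span ({s} : Set A)) : star x ∈ TwoSidedIdeal.span ({s} : Set A) := by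
  induction hx using TwoSidedIdeal.span_induction with
  | mem x h =>
    rw [Set.mem_singleton_iff] at h
    rw [h, hs.star_eq]
    exact TwoSidedIdeal.subset_span rfl
  | zero => rw [star_zero]; exact zero_mem _
  | add x y _ _ hx hy => rw [star_add]; exact add_mem hx hy
  | neg x _ hx => rw [star_neg]; exact neg_mem hx
  | left_absorb a x _ hx => rw [star_mul]; exact TwoSidedIdeal.mul_mem_right _ _ _ hx
  | right_absorb b x _ hx => rw [star_mul]; exact TwoSidedIdeal.mul_mem_left _ _ _ hx

/-- The closed two-sided ideal generated by a self-adjoint element `s`, namely the closure of the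
algebraic two-sided ideal that it generates, as a (nonunital) C⋆-subalgebra. -/
def closedIdeal (s : A) (hs : IsSelfAdjoint s) : NonUnitalStarSubalgebra ℂ A :=
  NonUnitalStarSubalgebra.topologicalClosure
    { carrier := (TwoSidedIdeal.span ({s} : Set A) : Set A)
      add_mem' := fun ha hb => add_mem ha hb
      zero_mem' := zero_mem _
      mul_mem' := fun _ hb => TwoSidedIdeal.mul_mem_left _ _ _ hb
      smul_mem' := fun c x hx => by
        have h : c • x = (c • (1 : A)) * x := by rw [smul_mul_assoc, one_mul]
        rw [h]
        exact TwoSidedIdeal.mul_mem_left _ _ _ hx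
      star_mem' := fun hx => star_mem_span hs hx }

theorem coe_closedIdeal (s : A) (hs : IsSelfAdjoint s) :
    (closedIdeal s hs : Set A) = closure (TwoSidedIdeal.span ({s} : Set A) : Set A) := rfl

instance isClosed_closedIdeal (s : A) (hs : IsSelfAdjoint s) :
    IsClosed (closedIdeal s hs : Set A) := isClosed_closure

end Ideal

/-! ### The crossed product `C*(𝔽₂) ⋊_σ ℤ/2` for the flip `σ` -/

/-- The crossed product `C*(𝔽₂) ⋊_σ ℤ/2`. -/
abbrev CrossedF2 : Type := CrossedProduct CStarF2.σ

namespace CrossedF2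

/-- The image of the first universal unitary. -/
def U : CrossedF2 := CrossedProduct.incl CStarF2.σ CStarF2.U

/-- The image of the second universal unitary. -/
def V : CrossedF2 := CrossedProduct.incl CStarF2.σ CStarF2.V

/-- The canonical unitary of the crossed product. -/
def W : CrossedF2 := CrossedProduct.W CStarF2.σ

/-- The relation `W U W = V`. -/
theorem W_mul_U_mul_W : W * U * W = V :=
  (CrossedProduct.W_mul_incl_mul_W CStarF2.σ CStarF2.U).trans
    (congrArg (CrossedProduct.incl CStarF2.σ) CStarF2.flipHom_U)

/-- The closed ideal `𝒥` generated by the projection `p = (1 + W) / 2`. -/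
abbrev J : NonUnitalStarSubalgebra ℂ CrossedF2 :=
  closedIdeal (CrossedProduct.p CStarF2.σ) (CrossedProduct.isSelfAdjoint_p CStarF2.σ)

end CrossedF2

/-! ### Strong Morita equivalence -/

/-- An `A`-`B` imprimitivity bimodule structure on the Banach space `X`: it is an `A`-`B`-bimodule
which is at the same time a full left Hilbert `A`-module and a full right Hilbert `B`-module, the
two structures being compatible. -/
structure ImprimitivityBimodule (A B X : Type u) [NonUnitalCStarAlgebra A]
    [NonUnitalCStarAlgebra B] [NormedAddCommGroup X] [NormedSpace ℂ X] [CompleteSpace X] where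
  /-- the left action `a x` -/
  lact : A →ₗ[ℂ] X →ₗ[ℂ] X
  /-- the right action `x b` -/
  ract : X →ₗ[ℂ] B →ₗ[ℂ] X
  /-- the left inner product, `A`-valued and linear in the first variable -/
  linner : X →ₗ[ℂ] X →ₗ⋆[ℂ] A
  /-- the right inner product, `B`-valued and linear in the second variable -/
  rinner : X →ₗ⋆[ℂ] X →ₗ[ℂ] B
  lact_mul : ∀ a a' x, lact (a * a') x = lact a (lact a' x)
  ract_mul : ∀ x b b', ract x (b * b') = ract (ract x b) b'
  lact_ract : ∀ a x b, ract (lact a x) b = lact a (ract x b)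
  linner_lact : ∀ a x y, linner (lact a x) y = a * linner x y
  rinner_ract : ∀ x y b, rinner x (ract y b) = rinner x y * b
  star_linner : ∀ x y, star (linner x y) = linner y x
  star_rinner : ∀ x y, star (rinner x y) = rinner y x
  linner_self_nonneg : ∀ x, ∃ a, linner x x = star a * a
  rinner_self_nonneg : ∀ x, ∃ b, rinner x x = star b * b
  norm_linner_self : ∀ x, ‖linner x x‖ = ‖x‖ ^ 2
  norm_rinner_self : ∀ x, ‖rinner x x‖ = ‖x‖ ^ 2
  linner_full : Dense (Submodule.span ℂ {a | ∃ x y, a = linner x y} : Set A)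
  rinner_full : Dense (Submodule.span ℂ {b | ∃ x y, b = rinner x y} : Set B)
  rinner_lact : ∀ a x y, rinner (lact a x) y = rinner x (lact (star a) y)
  linner_ract : ∀ x y b, linner (ract x b) y = linner x (ract y (star b))
  linner_lact_eq_ract_rinner : ∀ x y z, lact (linner x y) z = ract x (rinner y z)

/-- Two C⋆-algebras are strongly Morita equivalent when there is an imprimitivity bimodule between
them. -/
def StrongMoritaEquivalent (A B : Type u) [NonUnitalCStarAlgebra A] [NonUnitalCStarAlgebra B] :
    Prop :=
  ∃ (X : Type u) (_ : NormedAddCommGroup X) (_ : NormedSpace ℂ X) (_ : CompleteSpace X),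
    Nonempty (ImprimitivityBimodule A B X)

end SymmetricWords

end

/-!
Let `B = A ⋊_σ ℤ/2` with canonical unitary `W`, and `p = (1 + W) / 2`.

The Morita equivalence holds for every C⋆-algebra `A` with an involution `σ`. The bimodule is the
right ideal `p B`, with inner products `x y*` and `x* y`. The products `x* y` span the ideal
generated by `p`, and the products `x y*` lie in the corner `p B p`, so it suffices to identify
this corner with the fixed-point algebra. The map `a ↦ p a` is a `*`-homomorphism from the
fixed-point algebra to the corner, since fixed points commute with `W`. It is injective because
the matrix representation `a + b W ↦ !![a, b; σ b, σ a]` recovers `a` from `p a`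
(`cornerHom_injective`), hence isometric. It is onto because `p (a + b W) p = p E(a + b)`, where
`E(c) = (c + σ(c)) / 2`; the matrix representation also provides a continuous formula for the
preimage, which carries this from the algebraic crossed product to its completion (`corner`).

For `C*(𝔽₂)`, the homomorphism `φ` to `C(𝕋)` comes from the universal properties. Its values are
determined because `U` and `W` generate the crossed product (`CrossedF2.mem_of_generators_mem`).
The continuous functional calculus of the unitary `U` is a section `s` of `φ`, so `φ` is onto.
As `φ(p) = 0`, the ideal `J` is contained in the kernel. Conversely, the elements `x` with
`x - s(φ(x)) ∈ J` form a C⋆-subalgebra, which contains `U`, as `s(φ(U)) = U`, and `W`, as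
`s(φ(W)) = -1` and `W + 1 = 2 p`. Hence it is everything, and `φ(x) = 0` forces `x ∈ J`.
-/

noncomputable section

namespace SymmetricWords

universe u

-- The spectral order provides the order structure required by the norm of `CStarMatrix` and by
-- square roots of positive elements.
attribute [local instance] CStarAlgebra.spectralOrder CStarAlgebra.spectralOrderedRing

/-! ### The faithful matrix representation of the crossed product -/

namespace SkewAlgebra

variable {A : Type u} [CStarAlgebra A]

/-- The `2 × 2` matrix representation `a + b W ↦ !![a, b; σ b, σ a]` of the algebraic crossed
product, induced from the identity representation of `A`. -/
def toMatrix (σ : StarInvolution A) : SkewAlgebra σ →⋆ₐ[ℂ] CStarMatrix (Fin 2) (Fin 2) A where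
  toFun x := CStarMatrix.ofMatrix !![x.1, x.2; σ.aut x.2, σ.aut x.1]
  map_one' := by
    ext i j; fin_cases i <;> fin_cases j <;> simp
  map_zero' := by
    ext i j; fin_cases i <;> fin_cases j <;> simp
  map_mul' x y := by
    ext i j
    fin_cases i <;> fin_cases j <;>
      simp [CStarMatrix.mul_apply, σ.aut_aut, add_comm]
  map_add' x y := by
    ext i j; fin_cases i <;> fin_cases j <;> simp
  commutes' c := by
    rw [Algebra.algebraMap_eq_smul_one, Algebra.algebraMap_eq_smul_one]
    ext i j; fin_cases i <;> fin_cases j <;> simp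
  map_star' x := by
    ext i j
    fin_cases i <;> fin_cases j <;> simp [CStarMatrix.star_apply, ← map_star, σ.aut_aut]

end SkewAlgebra

namespace CrossedProduct

variable {A : Type u} [CStarAlgebra A] (σ : StarInvolution A)

/-- The matrix representation of the C⋆-crossed product. -/
def matrixRep : CrossedProduct σ →⋆ₐ[ℂ] CStarMatrix (Fin 2) (Fin 2) A :=
  CStarEnvelope.lift (B := CStarMatrix (Fin 2) (Fin 2) A) (SkewAlgebra.toMatrix σ)

theorem matrixRep_ofHom (x : SkewAlgebra σ) :
    matrixRep σ (CStarEnvelope.ofHom x) = SkewAlgebra.toMatrix σ x :=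
  CStarEnvelope.lift_ofHom (B := CStarMatrix (Fin 2) (Fin 2) A) _ x

theorem continuous_matrixRep_apply (i j : Fin 2) : Continuous fun x => matrixRep σ x i j :=
  have h : Continuous (matrixRep σ) := CStarEnvelope.continuous_starHom (matrixRep σ)
  -- the topology of `CStarMatrix` is by definition that of entrywise convergence
  (continuous_apply j).comp ((continuous_apply i).comp h)

/-- The extension of `a + b W ↦ a + b` to a bounded linear map on the crossed product: the sum of
the first row of the matrix representation. -/
def rowSum : CrossedProduct σ →ₗ[ℂ] A where
  toFun x := matrixRep σ x 0 0 + matrixRep σ x 0 1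
  map_add' x y := by simp only [map_add, CStarMatrix.add_apply]; abel
  map_smul' c x := by simp only [map_smul, CStarMatrix.smul_apply, smul_add, RingHom.id_apply]

theorem continuous_rowSum : Continuous (rowSum σ) :=
  (continuous_matrixRep_apply σ 0 0).add (continuous_matrixRep_apply σ 0 1)

theorem rowSum_ofHom (x : SkewAlgebra σ) : rowSum σ (CStarEnvelope.ofHom x) = x.1 + x.2 := by
  change matrixRep σ _ 0 0 + matrixRep σ _ 0 1 = _
  rw [matrixRep_ofHom]
  simp [SkewAlgebra.toMatrix]

/-! ### The corner of the projection `p` -/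

theorem p_eq_ofHom : p σ = CStarEnvelope.ofHom ⟨algebraMap ℂ A (1 / 2), algebraMap ℂ A (1 / 2)⟩ := by
  rw [p, W, ← map_one (CStarEnvelope.ofHom (𝒜 := SkewAlgebra σ)), ← map_add, ← map_smul]
  congr 1
  ext <;> simp [SkewAlgebra.W, Algebra.algebraMap_eq_smul_one]

theorem p_mul_p : p σ * p σ = p σ := by
  rw [p_eq_ofHom, ← map_mul]
  congr 1
  ext <;> simp [Algebra.algebraMap_eq_smul_one, smul_smul, ← add_smul] <;> norm_num

theorem p_mul_incl {a : A} (ha : a ∈ fixedPoints σ) : p σ * incl σ a = incl σ a * p σ := by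
  have ha' : σ.aut a = a := ha
  change p σ * CStarEnvelope.ofHom (SkewAlgebra.incl σ a)
    = CStarEnvelope.ofHom (SkewAlgebra.incl σ a) * p σ
  rw [p_eq_ofHom, ← map_mul, ← map_mul]
  congr 1
  ext <;> simp [SkewAlgebra.incl, ha', Algebra.algebraMap_eq_smul_one]

theorem rowSum_p_mul_incl {a : A} (ha : a ∈ fixedPoints σ) : rowSum σ (p σ * incl σ a) = a := by
  have ha' : σ.aut a = a := ha
  change rowSum σ (p σ * CStarEnvelope.ofHom (SkewAlgebra.incl σ a)) = a
  rw [p_eq_ofHom, ← map_mul, rowSum_ofHom]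
  simp [SkewAlgebra.incl, ha', Algebra.algebraMap_eq_smul_one, ← add_smul]
  norm_num

/-- Compression by `p` maps `a + b W` to `p E(a + b)`, where `E(c) = (c + σ(c)) / 2`; this is
checked on the dense algebraic crossed product and holds everywhere by continuity. -/
theorem corner (x : CrossedProduct σ) :
    rowSum σ (p σ * x * p σ) ∈ fixedPoints σ ∧
      p σ * incl σ (rowSum σ (p σ * x * p σ)) = p σ * x * p σ := by
  have hc : Continuous fun x : CrossedProduct σ => p σ * x * p σ := by fun_prop
  have hi : Continuous (incl σ) := CStarEnvelope.continuous_starHom _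
  have hr := (continuous_rowSum σ).comp hc
  induction x using CStarEnvelope.induction with
  | hp =>
    exact ((isClosed_fixedPoints σ).preimage hr).inter
      (isClosed_eq (continuous_const.mul (hi.comp hr)) hc)
  | h a =>
    change rowSum σ (p σ * CStarEnvelope.ofHom a * p σ) ∈ fixedPoints σ ∧
      p σ * CStarEnvelope.ofHom (SkewAlgebra.incl σ (rowSum σ (p σ * CStarEnvelope.ofHom a * p σ)))
        = p σ * CStarEnvelope.ofHom a * p σ
    rw [p_eq_ofHom, ← map_mul, ← map_mul, rowSum_ofHom, ← map_mul]
    constructor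
    · change σ.aut _ = _
      simp [Algebra.algebraMap_eq_smul_one, σ.aut_aut, smul_smul, ← smul_add]
      abel
    · congr 1
      ext <;>
      · simp [Algebra.algebraMap_eq_smul_one, σ.aut_aut, smul_smul, ← smul_add, SkewAlgebra.incl]
        module

/-- The embedding of the fixed-point algebra onto the corner of `p`. -/
def cornerHom : fixedPoints σ →⋆ₙₐ[ℂ] CrossedProduct σ where
  toFun a := p σ * incl σ a
  map_zero' := by simp
  map_add' a b := by simp [mul_add]
  map_smul' c a := by simp
  map_mul' a b := by
    rw [MulMemClass.coe_mul, map_mul, mul_assoc, ← mul_assoc (incl σ a), ← p_mul_incl σ a.2,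
      ← mul_assoc, ← mul_assoc, ← mul_assoc, p_mul_p]
  map_star' a := by
    change p σ * incl σ (star (a : A)) = star (p σ * incl σ a)
    rw [star_mul, (isSelfAdjoint_p σ).star_eq, ← map_star, p_mul_incl σ (star_mem a.2)]

theorem cornerHom_apply (a : fixedPoints σ) : cornerHom σ a = p σ * incl σ a := rfl

theorem cornerHom_injective : Function.Injective (cornerHom σ) := fun a b h => by
  have h' := congrArg (rowSum σ) h
  rw [cornerHom_apply, cornerHom_apply, rowSum_p_mul_incl σ a.2, rowSum_p_mul_incl σ b.2] at h'
  exact Subtype.ext h'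

theorem norm_cornerHom (a : fixedPoints σ) : ‖cornerHom σ a‖ = ‖a‖ :=
  NonUnitalStarAlgHom.norm_map _ (cornerHom_injective σ) a

end CrossedProduct

/-! ### Closed ideals -/

section ClosedIdeal

variable {B : Type u} [CStarAlgebra B] {s : B} (hs : IsSelfAdjoint s)

theorem subset_closedIdeal {x : B} (hx : x ∈ TwoSidedIdeal.span ({s} : Set B)) :
    x ∈ closedIdeal s hs := subset_closure hx

theorem self_mem_closedIdeal : s ∈ closedIdeal s hs :=
  subset_closedIdeal hs (TwoSidedIdeal.subset_span rfl)

theorem mul_mem_closedIdeal_left (a : B) {x : B} (hx : x ∈ closedIdeal s hs) :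
    a * x ∈ closedIdeal s hs :=
  map_mem_closure (f := (a * ·)) (by fun_prop) hx
    fun _ hy => TwoSidedIdeal.mul_mem_left _ _ _ hy

theorem mul_mem_closedIdeal_right {x : B} (hx : x ∈ closedIdeal s hs) (a : B) :
    x * a ∈ closedIdeal s hs :=
  map_mem_closure (f := (· * a)) (by fun_prop) hx
    fun _ hy => TwoSidedIdeal.mul_mem_right _ _ _ hy

/-- The closed ideal of `s` is contained in every closed set containing the ideal of `s`. -/
theorem closedIdeal_subset {K : Set B} (hK : IsClosed K)
    (h : ∀ x ∈ TwoSidedIdeal.span ({s} : Set B), x ∈ K) {x : B} (hx : x ∈ closedIdeal s hs) :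
    x ∈ K :=
  closure_minimal h hK hx

end ClosedIdeal

/-! ### The imprimitivity bimodule `p (A ⋊ ℤ/2)` -/

namespace CrossedProduct

variable {A : Type u} [CStarAlgebra A] (σ : StarInvolution A)

/-- In the algebraic crossed product `p (a + b W) = p (a + σ(b))`, and `p c` has matrix
coefficient `c / 2` in the upper left corner; hence `p (A ⋊ ℤ/2) = p A`. -/
theorem p_mul_eq_p_mul_incl (x : CrossedProduct σ) :
    p σ * x = p σ * incl σ ((2 : ℂ) • matrixRep σ (p σ * x) 0 0) := by
  have hc : Continuous fun x : CrossedProduct σ => p σ * x := by fun_prop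
  have hi : Continuous (incl σ) := CStarEnvelope.continuous_starHom _
  have hm := (continuous_matrixRep_apply σ 0 0).comp hc
  induction x using CStarEnvelope.induction with
  | hp => exact isClosed_eq hc (continuous_const.mul (hi.comp (hm.const_smul _)))
  | h a =>
    change p σ * CStarEnvelope.ofHom a = p σ * CStarEnvelope.ofHom (SkewAlgebra.incl σ
      ((2 : ℂ) • matrixRep σ (p σ * CStarEnvelope.ofHom a) 0 0))
    rw [p_eq_ofHom, ← map_mul, matrixRep_ofHom, ← map_mul]
    congr 1
    ext <;>
    · simp [SkewAlgebra.toMatrix, SkewAlgebra.incl, Algebra.algebraMap_eq_smul_one, σ.aut_aut,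
        smul_smul, ← smul_add]
      try module

theorem rowSum_p_mul_incl_mul_p (a : A) :
    rowSum σ (p σ * incl σ a * p σ) = (1 / 2 : ℝ) • (a + σ.aut a) := by
  change rowSum σ (p σ * CStarEnvelope.ofHom (SkewAlgebra.incl σ a) * p σ) = _
  rw [p_eq_ofHom, ← map_mul, ← map_mul, rowSum_ofHom]
  have h : (1 / 2 : ℝ) • (a + σ.aut a) = (1 / 2 : ℂ) • (a + σ.aut a) := by
    rw [← Complex.coe_smul]; norm_num
  rw [h]
  simp [SkewAlgebra.incl, Algebra.algebraMap_eq_smul_one, smul_smul]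
  module

/-- A positive element of the fixed-point algebra is a square there, since its positive square
root is unique and hence fixed by `σ`. -/
theorem exists_star_mul_self_of_nonneg {c : fixedPoints σ} (hc : 0 ≤ (c : A)) :
    ∃ d : fixedPoints σ, c = star d * d := by
  have hd : σ.aut (CFC.sqrt (c : A)) = CFC.sqrt (c : A) := by
    refine (CFC.sqrt_unique ?_ ?_).symm
    · rw [← map_mul, CFC.sqrt_mul_sqrt_self _ hc]
      exact c.2
    · exact map_nonneg σ.aut (CFC.sqrt_nonneg _)
  refine ⟨⟨CFC.sqrt (c : A), hd⟩, Subtype.ext ?_⟩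
  change (c : A) = star (CFC.sqrt (c : A)) * CFC.sqrt (c : A)
  rw [(CFC.sqrt_nonneg (c : A)).isSelfAdjoint.star_eq, CFC.sqrt_mul_sqrt_self _ hc]

/-- The closed right ideal `p (A ⋊ ℤ/2)`. -/
def rightIdeal : Submodule ℂ (CrossedProduct σ) where
  carrier := {x | p σ * x = x}
  add_mem' {x y} hx hy := by
    change p σ * (x + y) = x + y
    rw [mul_add, show p σ * x = x from hx, show p σ * y = y from hy]
  zero_mem' := mul_zero _
  smul_mem' c x hx := by
    change p σ * (c • x) = c • x
    rw [mul_smul_comm, show p σ * x = x from hx]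

variable {σ}

theorem p_mul (x : rightIdeal σ) : p σ * (x : CrossedProduct σ) = x := x.2

theorem star_mul_p (x : rightIdeal σ) :
    star (x : CrossedProduct σ) * p σ = star (x : CrossedProduct σ) := by
  conv_rhs => rw [← p_mul x, star_mul, (isSelfAdjoint_p σ).star_eq]

instance : CompleteSpace (rightIdeal σ) :=
  (show IsClosed {x : CrossedProduct σ | p σ * x = x} from
    isClosed_eq (by fun_prop) continuous_id).completeSpace_coe

theorem p_mul_mul_star_mul_p (x y : rightIdeal σ) :
    p σ * (x * star (y : CrossedProduct σ)) * p σ = x * star (y : CrossedProduct σ) := by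
  rw [← mul_assoc, p_mul, mul_assoc, star_mul_p]

/-- The inner product on `p (A ⋊ ℤ/2)` with values in the fixed-point algebra: the preimage of
`x y*` under the isomorphism of the fixed-point algebra with the corner of `p`. -/
def cornerInner (x y : rightIdeal σ) : fixedPoints σ :=
  ⟨rowSum σ (x * star (y : CrossedProduct σ)), by
    rw [← p_mul_mul_star_mul_p]
    exact (corner σ _).1⟩

theorem cornerHom_cornerInner (x y : rightIdeal σ) :
    cornerHom σ (cornerInner x y) = x * star (y : CrossedProduct σ) := by
  have h := (corner σ (x * star (y : CrossedProduct σ))).2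
  rwa [p_mul_mul_star_mul_p] at h

theorem cornerInner_self_nonneg (x : rightIdeal σ) : 0 ≤ (cornerInner x x : A) := by
  obtain ⟨a, ha⟩ : ∃ a, (x : CrossedProduct σ) = p σ * incl σ a :=
    ⟨_, by rw [← p_mul_eq_p_mul_incl, p_mul]⟩
  change 0 ≤ rowSum σ (x * star (x : CrossedProduct σ))
  have h : (x : CrossedProduct σ) * star (x : CrossedProduct σ)
      = p σ * incl σ (a * star a) * p σ := by
    rw [ha, star_mul, (isSelfAdjoint_p σ).star_eq, map_mul, map_star]
    simp only [mul_assoc]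
  rw [h, rowSum_p_mul_incl_mul_p]
  have h0 : 0 ≤ a * star a := mul_star_self_nonneg a
  exact smul_nonneg (by norm_num) (add_nonneg h0 (map_nonneg σ.aut h0))

variable (σ) in
/-- The closed ideal of the crossed product generated by `p`. -/
abbrev idealP : NonUnitalStarSubalgebra ℂ (CrossedProduct σ) :=
  closedIdeal (p σ) (isSelfAdjoint_p σ)

theorem rightIdeal_mem_idealP (x : rightIdeal σ) : (x : CrossedProduct σ) ∈ idealP σ := by
  rw [← p_mul x]
  exact mul_mem_closedIdeal_right _ (self_mem_closedIdeal _) _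

/-- The left action of the fixed-point algebra on `p (A ⋊ ℤ/2)`; it is defined because
the fixed-point algebra commutes with `p`. -/
def leftAction : fixedPoints σ →ₗ[ℂ] rightIdeal σ →ₗ[ℂ] rightIdeal σ :=
  LinearMap.mk₂ ℂ
    (fun a x => ⟨incl σ a * x, by
      change p σ * (incl σ a * x) = incl σ a * x
      rw [← mul_assoc, p_mul_incl σ a.2, mul_assoc, p_mul]⟩)
    (fun a b x => Subtype.ext (by simp [add_mul]))
    (fun c a x => Subtype.ext (by simp))
    (fun a x y => Subtype.ext (by simp [mul_add]))
    (fun c a x => Subtype.ext (by simp))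

theorem coe_leftAction (a : fixedPoints σ) (x : rightIdeal σ) :
    (leftAction a x : CrossedProduct σ) = incl σ a * x := rfl

/-- The right action of the ideal generated by `p` on `p (A ⋊ ℤ/2)`, by multiplication. -/
def rightAction : rightIdeal σ →ₗ[ℂ] idealP σ →ₗ[ℂ] rightIdeal σ :=
  LinearMap.mk₂ ℂ
    (fun x b => ⟨x * b, by
      change p σ * (x * b) = x * b
      rw [← mul_assoc, p_mul]⟩)
    (fun x y b => Subtype.ext (by simp [add_mul]))
    (fun c x b => Subtype.ext (by simp))
    (fun x b b' => Subtype.ext (by simp [mul_add]))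
    (fun c x b => Subtype.ext (by simp))

theorem coe_rightAction (x : rightIdeal σ) (b : idealP σ) :
    (rightAction x b : CrossedProduct σ) = x * b := rfl

/-- `cornerInner` as a sesquilinear map, linear in the first variable. -/
def leftInner : rightIdeal σ →ₗ[ℂ] rightIdeal σ →ₗ⋆[ℂ] fixedPoints σ :=
  LinearMap.mk₂'ₛₗ _ _ cornerInner
    (fun x y z => Subtype.ext (by simp [cornerInner, add_mul]))
    (fun c x y => Subtype.ext (by simp [cornerInner]))
    (fun x y z => Subtype.ext (by simp [cornerInner, mul_add]))
    (fun c x y => Subtype.ext (by simp [cornerInner]))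

theorem cornerHom_leftInner (x y : rightIdeal σ) :
    cornerHom σ (leftInner x y) = x * star (y : CrossedProduct σ) := cornerHom_cornerInner x y

/-- The inner product `x* y` on `p (A ⋊ ℤ/2)`, with values in the ideal generated by `p`. -/
def rightInner : rightIdeal σ →ₗ⋆[ℂ] rightIdeal σ →ₗ[ℂ] idealP σ :=
  LinearMap.mk₂'ₛₗ _ _
    (fun x y => ⟨star (x : CrossedProduct σ) * y,
      mul_mem_closedIdeal_left _ _ (rightIdeal_mem_idealP y)⟩)
    (fun x y z => Subtype.ext (by simp [add_mul]))
    (fun c x y => Subtype.ext (by simp))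
    (fun x y z => Subtype.ext (by simp [mul_add]))
    (fun c x y => Subtype.ext (by simp))

theorem coe_rightInner (x y : rightIdeal σ) :
    (rightInner x y : CrossedProduct σ) = star (x : CrossedProduct σ) * y := rfl

/-- The algebraic ideal generated by `p = p* p` consists of sums of products `x* y` with
`x, y ∈ p (A ⋊ ℤ/2)`. -/
theorem mem_span_rightInner {z : CrossedProduct σ}
    (hz : z ∈ TwoSidedIdeal.span ({p σ} : Set (CrossedProduct σ))) :
    z ∈ Submodule.span ℂ {b : CrossedProduct σ | ∃ x y : rightIdeal σ, b = rightInner x y} := by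
  have hmul : ∀ (x : rightIdeal σ) (a : CrossedProduct σ),
      (x : CrossedProduct σ) * a ∈ rightIdeal σ := fun x a => by
    change p σ * (x * a) = x * a
    rw [← mul_assoc, p_mul]
  induction hz using TwoSidedIdeal.span_induction with
  | mem x h =>
    rw [Set.mem_singleton_iff] at h
    refine Submodule.subset_span ⟨⟨p σ, p_mul_p σ⟩, ⟨p σ, p_mul_p σ⟩, ?_⟩
    rw [coe_rightInner, h, (isSelfAdjoint_p σ).star_eq, p_mul_p]
  | zero => exact zero_mem _
  | add x y _ _ hx hy => exact add_mem hx hy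
  | neg x _ hx => exact neg_mem hx
  | left_absorb a z _ hz =>
    refine Submodule.span_le (p := (Submodule.span ℂ _).comap (LinearMap.mulLeft ℂ a)) |>.2 ?_ hz
    rintro _ ⟨x, y, rfl⟩
    refine Submodule.subset_span ⟨⟨x * star a, hmul x _⟩, y, ?_⟩
    simp [coe_rightInner, mul_assoc]
  | right_absorb a z _ hz =>
    refine Submodule.span_le (p := (Submodule.span ℂ _).comap (LinearMap.mulRight ℂ a)) |>.2 ?_ hz
    rintro _ ⟨x, y, rfl⟩
    refine Submodule.subset_span ⟨x, ⟨y * a, hmul y _⟩, ?_⟩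
    simp [coe_rightInner, mul_assoc]

theorem dense_span_rightInner :
    Dense (Submodule.span ℂ {b : idealP σ | ∃ x y, b = rightInner x y} : Set (idealP σ)) := by
  intro b
  rw [Topology.IsInducing.subtypeVal.closure_eq_preimage_closure_image]
  refine closure_mono (fun z hz => ?_) b.2
  have h := mem_span_rightInner hz
  have himage : {b : CrossedProduct σ | ∃ x y : rightIdeal σ, b = rightInner x y}
      = (NonUnitalStarSubalgebraClass.subtype (idealP σ) : idealP σ →ₗ[ℂ] CrossedProduct σ) ''
        {b : idealP σ | ∃ x y, b = rightInner x y} := by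
    ext z
    constructor
    · rintro ⟨x, y, rfl⟩
      exact ⟨_, ⟨x, y, rfl⟩, rfl⟩
    · rintro ⟨_, ⟨x, y, rfl⟩, rfl⟩
      exact ⟨x, y, rfl⟩
  rw [himage, Submodule.span_image] at h
  exact h

theorem exists_leftInner_eq (a : fixedPoints σ) : ∃ x y : rightIdeal σ, a = leftInner x y := by
  refine ⟨leftAction a ⟨p σ, p_mul_p σ⟩, ⟨p σ, p_mul_p σ⟩, cornerHom_injective σ ?_⟩
  rw [cornerHom_leftInner, coe_leftAction, cornerHom_apply, (isSelfAdjoint_p σ).star_eq,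
    mul_assoc, p_mul_p, p_mul_incl σ a.2]

variable (σ) in
/-- The right ideal `p (A ⋊ ℤ/2)` as an imprimitivity bimodule between the fixed-point algebra,
identified with the corner of `p`, and the closed ideal generated by `p`. Identities between
elements of the fixed-point algebra are checked in the corner. -/
def imprimitivityBimodule :
    ImprimitivityBimodule (fixedPoints σ) (idealP σ) (rightIdeal σ) where
  lact := leftAction
  ract := rightAction
  linner := leftInner
  rinner := rightInner
  lact_mul a b x := Subtype.ext (by simp [coe_leftAction, mul_assoc])
  ract_mul x b c := Subtype.ext (by simp [coe_rightAction, mul_assoc])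
  lact_ract a x b := Subtype.ext (by simp [coe_rightAction, coe_leftAction, mul_assoc])
  linner_lact a x y := cornerHom_injective σ (by
    rw [map_mul, cornerHom_leftInner, cornerHom_leftInner, coe_leftAction, cornerHom_apply,
      p_mul_incl σ a.2, mul_assoc, mul_assoc, ← mul_assoc (p σ), p_mul])
  rinner_ract x y b := Subtype.ext (by simp [coe_rightInner, coe_rightAction, mul_assoc])
  star_linner x y := cornerHom_injective σ (by
    rw [map_star, cornerHom_leftInner, cornerHom_leftInner, star_mul, star_star])
  star_rinner x y := Subtype.ext (by
    change star (rightInner x y : CrossedProduct σ) = rightInner y x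
    rw [coe_rightInner, coe_rightInner, star_mul, star_star])
  linner_self_nonneg x := exists_star_mul_self_of_nonneg σ (cornerInner_self_nonneg x)
  rinner_self_nonneg x := ⟨⟨x, rightIdeal_mem_idealP x⟩, rfl⟩
  norm_linner_self x := by
    rw [← norm_cornerHom, cornerHom_leftInner, CStarRing.norm_self_mul_star, sq]
    rfl
  norm_rinner_self x := by
    change ‖star (x : CrossedProduct σ) * x‖ = _
    rw [CStarRing.norm_star_mul_self, sq]
    rfl
  linner_full a := subset_closure (Submodule.subset_span (exists_leftInner_eq a))
  rinner_full := dense_span_rightInner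
  rinner_lact a x y := Subtype.ext (by
    rw [coe_rightInner, coe_rightInner, coe_leftAction, coe_leftAction, star_mul, ← map_star,
      mul_assoc]
    rfl)
  linner_ract x y b := cornerHom_injective σ (by
    rw [cornerHom_leftInner, cornerHom_leftInner, coe_rightAction, coe_rightAction, star_mul,
      mul_assoc]
    simp)
  linner_lact_eq_ract_rinner x y z := Subtype.ext (by
    rw [coe_leftAction, coe_rightAction, coe_rightInner, ← mul_assoc, ← cornerHom_leftInner,
      cornerHom_apply, p_mul_incl σ (leftInner x y).2, mul_assoc, p_mul])

end CrossedProduct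

/-! ### Generation of `C*(𝔽₂) ⋊ ℤ/2` by `U` and `W` -/

namespace CStarF2

theorem groupCStar_of_mul (g h : FreeGroup (Fin 2)) :
    GroupCStar.of (g * h) = GroupCStar.of g * GroupCStar.of h := by
  rw [GroupCStar.of, GroupCStar.of, GroupCStar.of, ← map_mul, MonoidAlgebra.single_mul_single,
    one_mul]

theorem star_groupCStar_of (g : FreeGroup (Fin 2)) :
    star (GroupCStar.of g) = GroupCStar.of g⁻¹ := by
  rw [GroupCStar.of, GroupCStar.of, ← map_star, star_single, star_one]

theorem groupCStar_of_one : GroupCStar.of (1 : FreeGroup (Fin 2)) = 1 := by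
  rw [GroupCStar.of, ← MonoidAlgebra.one_def, map_one]

/-- `C*(𝔽₂)` is generated by `U` and `V` as a C⋆-algebra. -/
theorem mem_of_generators_mem (S : StarSubalgebra ℂ CStarF2) (hS : IsClosed (S : Set CStarF2))
    (hU : U ∈ S) (hV : V ∈ S) (x : CStarF2) : x ∈ S := by
  have hg : ∀ g : FreeGroup (Fin 2), GroupCStar.of g ∈ S := by
    intro g
    induction g using FreeGroup.induction_on with
    | C1 => rw [groupCStar_of_one]; exact one_mem S
    | of i => fin_cases i <;> assumption
    | inv_of i hi => rw [← star_groupCStar_of]; exact star_mem hi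
    | mul g h hg hh => rw [groupCStar_of_mul]; exact mul_mem hg hh
  induction x using CStarEnvelope.induction with
  | hp => exact hS
  | h a =>
    change CStarEnvelope.ofHom a ∈ S
    induction a using MonoidAlgebra.induction_linear with
    | zero => rw [map_zero]; exact zero_mem S
    | add x y hx hy => rw [map_add]; exact add_mem hx hy
    | single g c =>
      rw [show MonoidAlgebra.single g c = c • MonoidAlgebra.single g (1 : ℂ) by
        rw [MonoidAlgebra.smul_single, smul_eq_mul, mul_one], map_smul]
      exact S.smul_mem (hg g) c

end CStarF2

namespace CrossedF2

/-- `C*(𝔽₂) ⋊ ℤ/2` is generated by `U` and `W` as a C⋆-algebra. -/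
theorem mem_of_generators_mem (S : StarSubalgebra ℂ CrossedF2)
    (hS : IsClosed (S : Set CrossedF2)) (hU : U ∈ S) (hW : W ∈ S) (x : CrossedF2) : x ∈ S := by
  have hV : V ∈ S := by
    rw [← W_mul_U_mul_W]
    exact mul_mem (mul_mem hW hU) hW
  have hA : ∀ a, CrossedProduct.incl CStarF2.σ a ∈ S :=
    CStarF2.mem_of_generators_mem (S.comap (CrossedProduct.incl CStarF2.σ))
      (hS.preimage (CStarEnvelope.continuous_starHom (CrossedProduct.incl CStarF2.σ))) hU hV
  induction x using CStarEnvelope.induction with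
  | hp => exact hS
  | h a =>
    change CStarEnvelope.ofHom a ∈ S
    rw [SkewAlgebra.eq_incl_add a, map_add, map_mul]
    exact add_mem (hA _) (mul_mem (hA _) hW)

/-! ### The homomorphism to `C(𝕋)` -/

/-- The coordinate function `z ↦ z` on the circle. -/
def coord : C(Circle, ℂ) := ⟨fun z => z, continuous_subtype_val⟩

theorem star_coord_mul_coord : star coord * coord = 1 := by
  ext z
  change (starRingEnd ℂ) (z : ℂ) * z = 1
  rw [← Circle.coe_inv_eq_conj, ← Circle.coe_mul, inv_mul_cancel, Circle.coe_one]

theorem coord_mem_unitary : coord ∈ unitary C(Circle, ℂ) :=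
  Unitary.mem_iff.2 ⟨star_coord_mul_coord, by rw [mul_comm, star_coord_mul_coord]⟩

/-- The representation of `𝔽₂` sending both generators to the coordinate function. -/
def freeGroupRep : FreeGroup (Fin 2) →* unitary C(Circle, ℂ) :=
  FreeGroup.lift fun _ => ⟨coord, coord_mem_unitary⟩

/-- The extension of `freeGroupRep` to the group algebra. -/
def groupAlgebraRep : MonoidAlgebra ℂ (FreeGroup (Fin 2)) →⋆ₐ[ℂ] C(Circle, ℂ) :=
  { MonoidAlgebra.lift ℂ C(Circle, ℂ) (FreeGroup (Fin 2))
      ((unitary C(Circle, ℂ)).subtype.comp freeGroupRep) with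
    map_star' := fun x => by
      change MonoidAlgebra.lift ℂ C(Circle, ℂ) (FreeGroup (Fin 2)) _ (star x)
        = star (MonoidAlgebra.lift ℂ C(Circle, ℂ) (FreeGroup (Fin 2)) _ x)
      induction x using MonoidAlgebra.induction_linear with
      | zero => simp only [star_zero, map_zero]
      | add x y hx hy => simp only [star_add, map_add, hx, hy]
      | single g c =>
        rw [star_single, MonoidAlgebra.lift_single, MonoidAlgebra.lift_single, star_smul]
        congr 1
        change ((freeGroupRep g⁻¹ : unitary C(Circle, ℂ)) : C(Circle, ℂ)) = _
        rw [map_inv]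
        rfl }

/-- The `*`-homomorphism `C*(𝔽₂) → C(𝕋)` with `U, V ↦ z`. -/
def repF2 : CStarF2 →⋆ₐ[ℂ] C(Circle, ℂ) := CStarEnvelope.lift groupAlgebraRep

theorem repF2_of (i : Fin 2) : repF2 (GroupCStar.of (FreeGroup.of i)) = coord := by
  rw [repF2, GroupCStar.of, CStarEnvelope.lift_ofHom]
  change MonoidAlgebra.lift ℂ C(Circle, ℂ) (FreeGroup (Fin 2)) _ _ = coord
  rw [MonoidAlgebra.lift_single, one_smul]
  change ((freeGroupRep (FreeGroup.of i) : unitary C(Circle, ℂ)) : C(Circle, ℂ)) = coord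
  rw [freeGroupRep, FreeGroup.lift_apply_of]

theorem repF2_σ (a : CStarF2) : repF2 (CStarF2.σ.aut a) = repF2 a := by
  have hσ := CStarEnvelope.continuous_starHom CStarF2.flipHom
  have hr := CStarEnvelope.continuous_starHom repF2
  refine CStarF2.mem_of_generators_mem
    (StarAlgHom.equalizer (repF2.comp CStarF2.flipHom) repF2)
    (isClosed_eq (hr.comp hσ) hr) ?_ ?_ a
  · change repF2 (CStarF2.flipHom CStarF2.U) = repF2 CStarF2.U
    rw [CStarF2.flipHom_U]
    exact (repF2_of 1).trans (repF2_of 0).symm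
  · change repF2 (CStarF2.flipHom CStarF2.V) = repF2 CStarF2.V
    rw [CStarF2.flipHom_V]
    exact (repF2_of 0).trans (repF2_of 1).symm

/-- The `*`-homomorphism `a + b W ↦ repF2 a - repF2 b`. -/
def skewRep : SkewAlgebra CStarF2.σ →⋆ₐ[ℂ] C(Circle, ℂ) where
  toFun x := repF2 x.1 - repF2 x.2
  map_one' := by simp
  map_zero' := by simp
  map_mul' x y := by
    simp only [SkewAlgebra.mul_fst, SkewAlgebra.mul_snd, map_add, map_mul, repF2_σ]
    ring
  map_add' x y := by
    simp only [SkewAlgebra.add_fst, SkewAlgebra.add_snd, map_add]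
    ring
  commutes' c := by
    rw [Algebra.algebraMap_eq_smul_one, Algebra.algebraMap_eq_smul_one]
    simp
  map_star' x := by
    simp only [SkewAlgebra.star_fst, SkewAlgebra.star_snd, repF2_σ, map_star, star_sub]

/-- The `*`-homomorphism `C*(𝔽₂) ⋊ ℤ/2 → C(𝕋)` with `U, V ↦ z` and `W ↦ -1`. -/
def toCircle : CrossedF2 →⋆ₐ[ℂ] C(Circle, ℂ) := CStarEnvelope.lift skewRep

theorem toCircle_incl (a : CStarF2) :
    toCircle (CrossedProduct.incl CStarF2.σ a) = repF2 a := by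
  change CStarEnvelope.lift skewRep (CStarEnvelope.ofHom (SkewAlgebra.incl _ a)) = _
  rw [CStarEnvelope.lift_ofHom]
  change repF2 a - repF2 0 = repF2 a
  rw [map_zero, sub_zero]

theorem toCircle_U : toCircle U = coord := (toCircle_incl _).trans (repF2_of 0)

theorem toCircle_V : toCircle V = coord := (toCircle_incl _).trans (repF2_of 1)

theorem toCircle_W : toCircle W = -1 := by
  change CStarEnvelope.lift skewRep (CStarEnvelope.ofHom (SkewAlgebra.W _)) = _
  rw [CStarEnvelope.lift_ofHom]
  change repF2 0 - repF2 1 = -1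
  rw [map_zero, map_one, zero_sub]

theorem starHom_ext {ψ χ : CrossedF2 →⋆ₐ[ℂ] C(Circle, ℂ)} (hU : ψ U = χ U) (hW : ψ W = χ W) :
    ψ = χ :=
  StarAlgHom.ext <| mem_of_generators_mem (StarAlgHom.equalizer ψ χ)
    (isClosed_eq (CStarEnvelope.continuous_starHom ψ) (CStarEnvelope.continuous_starHom χ)) hU hW

/-! ### A section of the homomorphism to `C(𝕋)` -/

theorem U_mem_unitary : U ∈ unitary CrossedF2 := by
  have h : CStarF2.U ∈ unitary CStarF2 := by
    rw [Unitary.mem_iff, CStarF2.U, CStarF2.star_groupCStar_of, ← CStarF2.groupCStar_of_mul,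
      ← CStarF2.groupCStar_of_mul, inv_mul_cancel, mul_inv_cancel, CStarF2.groupCStar_of_one]
    exact ⟨rfl, rfl⟩
  exact Unitary.map_mem (CrossedProduct.incl CStarF2.σ) h

instance isStarNormal_U : IsStarNormal U :=
  ⟨by
    have h := Unitary.mem_iff.1 U_mem_unitary
    exact h.1.trans h.2.symm⟩

/-- The spectrum of the unitary `U` lies in the circle. -/
def spectrumToCircle : C(spectrum ℂ U, Circle) where
  toFun z := ⟨z, spectrum.subset_circle_of_unitary U_mem_unitary z.2⟩
  continuous_toFun := continuous_subtype_val.subtype_mk _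

/-- The continuous functional calculus `f ↦ f(U)` of the unitary `U`. -/
def ofCircle : C(Circle, ℂ) →⋆ₐ[ℂ] CrossedF2 :=
  (cfcHom (R := ℂ) (isStarNormal_U : IsStarNormal U)).comp
    (spectrumToCircle.compStarAlgHom' ℂ ℂ)

theorem ofCircle_coord : ofCircle coord = U := by
  refine Eq.trans ?_ (cfcHom_id (R := ℂ) (isStarNormal_U : IsStarNormal U))
  rfl

theorem separatesPoints_of_coord_mem (S : StarSubalgebra ℂ C(Circle, ℂ)) (h : coord ∈ S) :
    S.SeparatesPoints := fun _ _ hzw =>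
  ⟨coord, ⟨coord, h, rfl⟩, fun h' => hzw (Circle.coe_injective h')⟩

/-- By the Stone–Weierstrass theorem `C(𝕋)` is generated by the coordinate function, which
`toCircle ∘ ofCircle` fixes. -/
theorem toCircle_ofCircle (f : C(Circle, ℂ)) : toCircle (ofCircle f) = f := by
  let S := StarAlgHom.equalizer (toCircle.comp ofCircle) (StarAlgHom.id ℂ C(Circle, ℂ))
  have hclosed : IsClosed (S : Set C(Circle, ℂ)) :=
    isClosed_eq (CStarEnvelope.continuous_starHom (toCircle.comp ofCircle)) continuous_id
  have hmem : coord ∈ S := by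
    change toCircle (ofCircle coord) = coord
    rw [ofCircle_coord, toCircle_U]
  have htop := ContinuousMap.starSubalgebra_topologicalClosure_eq_top_of_separatesPoints S
    (separatesPoints_of_coord_mem S hmem)
  have hf : f ∈ S.topologicalClosure := htop ▸ StarSubalgebra.mem_top
  exact hclosed.closure_subset hf

/-! ### The kernel -/

theorem toCircle_eq_zero_of_mem_J {x : CrossedF2} (hx : x ∈ J) : toCircle x = 0 := by
  refine closedIdeal_subset _ (K := {x | toCircle x = 0})
    (isClosed_eq (CStarEnvelope.continuous_starHom toCircle) continuous_const) ?_ hx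
  have hp : toCircle (CrossedProduct.p CStarF2.σ) = 0 := by
    change toCircle ((1 / 2 : ℂ) • (1 + W)) = 0
    rw [map_smul, map_add, map_one, toCircle_W, add_neg_cancel, smul_zero]
  intro x hx
  induction hx using TwoSidedIdeal.span_induction with
  | mem x h => rw [Set.mem_singleton_iff.1 h]; exact hp
  | zero => exact map_zero _
  | add x y _ _ hx hy =>
    change toCircle (x + y) = 0
    rw [map_add, show toCircle x = 0 from hx, show toCircle y = 0 from hy, add_zero]
  | neg x _ hx =>
    change toCircle (-x) = 0
    rw [map_neg, show toCircle x = 0 from hx, neg_zero]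
  | left_absorb a x _ hx =>
    change toCircle (a * x) = 0
    rw [map_mul, show toCircle x = 0 from hx, mul_zero]
  | right_absorb a x _ hx =>
    change toCircle (x * a) = 0
    rw [map_mul, show toCircle x = 0 from hx, zero_mul]

/-- The elements that agree with `ofCircle (toCircle x)` modulo the ideal `J`. They form a
C⋆-subalgebra because `J` is a closed self-adjoint ideal. -/
def agreeModJ : StarSubalgebra ℂ CrossedF2 where
  carrier := {x | x - ofCircle (toCircle x) ∈ J}
  mul_mem' {x y} hx hy := by
    change x * y - ofCircle (toCircle (x * y)) ∈ J
    rw [map_mul, map_mul, show x * y - ofCircle (toCircle x) * ofCircle (toCircle y)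
      = (x - ofCircle (toCircle x)) * y
        + ofCircle (toCircle x) * (y - ofCircle (toCircle y)) by noncomm_ring]
    exact add_mem (mul_mem_closedIdeal_right _ hx _) (mul_mem_closedIdeal_left _ _ hy)
  add_mem' {x y} hx hy := by
    change x + y - ofCircle (toCircle (x + y)) ∈ J
    rw [map_add, map_add, add_sub_add_comm]
    exact add_mem hx hy
  algebraMap_mem' c := by
    change _ - _ ∈ J
    rw [AlgHomClass.commutes, AlgHomClass.commutes, sub_self]
    exact zero_mem _
  star_mem' {x} hx := by
    change star x - ofCircle (toCircle (star x)) ∈ J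
    rw [map_star, map_star, ← star_sub]
    exact star_mem hx

theorem sub_ofCircle_toCircle_mem_J (x : CrossedF2) : x - ofCircle (toCircle x) ∈ J := by
  refine mem_of_generators_mem agreeModJ ?_ ?_ ?_ x
  · have hc : Continuous fun x : CrossedF2 => x - ofCircle (toCircle x) :=
      continuous_id.sub (CStarEnvelope.continuous_starHom (ofCircle.comp toCircle))
    exact (isClosed_closedIdeal _ (CrossedProduct.isSelfAdjoint_p CStarF2.σ)).preimage hc
  · change U - ofCircle (toCircle U) ∈ J
    rw [toCircle_U, ofCircle_coord, sub_self]
    exact zero_mem _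
  · change W - ofCircle (toCircle W) ∈ J
    have h : W - ofCircle (toCircle W) = (2 : ℂ) • CrossedProduct.p CStarF2.σ := by
      rw [toCircle_W, map_neg, map_one, CrossedProduct.p, smul_smul]
      norm_num
      exact add_comm _ _
    rw [h]
    exact SMulMemClass.smul_mem _ (self_mem_closedIdeal _)

theorem coe_J_eq_ker : (J : Set CrossedF2) = {x | toCircle x = 0} := by
  ext x
  refine ⟨toCircle_eq_zero_of_mem_J, fun hx => ?_⟩
  have h := sub_ofCircle_toCircle_mem_J x
  rwa [show toCircle x = 0 from hx, map_zero, sub_zero] at h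

end CrossedF2

end SymmetricWords

end

theorem mainTheorem5 :
    SymmetricWords.StrongMoritaEquivalent
        (SymmetricWords.fixedPoints SymmetricWords.CStarF2.σ) SymmetricWords.CrossedF2.J ∧
      ∃ φ : SymmetricWords.CrossedF2 →⋆ₐ[ℂ] C(Circle, ℂ),
        (φ SymmetricWords.CrossedF2.W = -1 ∧
          (∀ z : Circle, φ SymmetricWords.CrossedF2.U z = (z : ℂ)) ∧
          (∀ z : Circle, φ SymmetricWords.CrossedF2.V z = (z : ℂ))) ∧
        (∀ ψ : SymmetricWords.CrossedF2 →⋆ₐ[ℂ] C(Circle, ℂ),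
          ψ SymmetricWords.CrossedF2.W = -1 →
          (∀ z : Circle, ψ SymmetricWords.CrossedF2.U z = (z : ℂ)) →
          (∀ z : Circle, ψ SymmetricWords.CrossedF2.V z = (z : ℂ)) → ψ = φ) ∧
        Function.Surjective φ ∧
        (SymmetricWords.CrossedF2.J : Set SymmetricWords.CrossedF2) = {x | φ x = 0} := by
  open SymmetricWords CrossedF2 in
  refine ⟨⟨CrossedProduct.rightIdeal CStarF2.σ, inferInstance, inferInstance, inferInstance,
    ⟨CrossedProduct.imprimitivityBimodule CStarF2.σ⟩⟩, toCircle, ⟨toCircle_W, ?_, ?_⟩, ?_,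
    fun f => ⟨ofCircle f, toCircle_ofCircle f⟩, coe_J_eq_ker⟩
  · intro z
    rw [toCircle_U]
    rfl
  · intro z
    rw [toCircle_V]
    rfl
  · intro ψ hW hU _
    refine starHom_ext (ContinuousMap.ext fun z => ?_) (hW.trans toCircle_W.symm)
    rw [toCircle_U]
    exact hU z
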